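/- **Proposition 7.** Let $1\le k<n$, $\mu\in\mathbb R\setminus\{0\}$, $\lambda>0$, $c>0$. Let $C^n_k$ be the set of all $k$-element subsets of $\{1,\dots,n\}$, put $N=\binom nk=|C^n_k|$, and let $p_i\ge 0$ $(i\in C^n_k)$ with $\sum_{i} p_i=1$. Let $B=(B^1,\dots,B^n)$ be a standard $n$-dimensional Brownian motion (with continuous paths, $B_0=0$) on a probability space $(\Omega,\mathcal F,\mathsf P)$. For $\varphi=(\varphi_i)_{i\in C^n_k}\in[0,\infty)^N$ let $\varPhi=(\varPhi^i)_{i\in C^n_k}$ be the process started at $\varphi$ given by $$\varPhi^i_t=e^{\lambda t}L^i_t\Big(\varphi_i+\lambda\int_0^t\frac{ds}{e^{\lambda s}L^i_s}\Big),\qquad L^i_t=\exp\Big(\mu\sum_{j\in i}B^j_t-k\,\frac{\mu^2}{2}\,t\Big)\qquad(t\ge0),$$ and write $\mathsf P_\varphi$, $\mathsf E_\varphi$ for probability and expectation when $\varPhi_0=\varphi$. Define $$\hat V(\varphi)=\inf_\tau \mathsf E_\varphi\Big[\int_0^\tau e^{-\lambda t}\Big(\sum_{i}p_i\varPhi^i_t-\frac{\lambda}{c}\Big)dt\Big],$$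 where the infimum is over all stopping times $\tau$ (with values in $[0,\infty]$) of the natural filtration of $\varPhi$, the expectation being allowed to equal $+\infty$. Let $C=\{\varphi\in[0,\infty)^N:\hat V(\varphi)<0\}$ be the continuation set, $D=\{\varphi\in[0,\infty)^N:\hat V(\varphi)=0\}$ the stopping set, and let $\partial C$ be the topological boundary of $C$ in $[0,\infty)^N$. Then $\partial C$ is probabilistically regular for $D$: for every $\varphi\in\partial C$, $$\mathsf P_\varphi(\sigma_D=0)=1,\qquad\text{where }\ \sigma_D=\inf\{t>0:\varPhi_t\in D\}.$$ -/

import Mathlib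

open MeasureTheory ProbabilityTheory
open scoped NNReal ENNReal

noncomputable section

namespace QuickestDetection

/-- A standard `n`-dimensional Brownian motion: independent coordinate processes, each of which is
a standard real Brownian motion, realised with every path continuous and started at the origin. -/
structure IsStandardBrownian {Ω : Type*} [MeasurableSpace Ω] {n : ℕ}
    (B : Fin n → ℝ≥0 → Ω → ℝ) (P : Measure Ω) : Prop where
  brownian : ∀ j, IsBrownianReal (B j) P
  indep : iIndepFun (fun j ω t => B j t ω) P
  measurable : ∀ j t, Measurable (B j t)
  continuous : ∀ j ω, Continuous fun t => B j t ω
  zero : ∀ j ω, B j 0 ω = 0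

/-- The `N = n.choose k` subsets of `{1, …, n}` with exactly `k` elements. -/
abbrev Idx (n k : ℕ) : Type := {S : Finset (Fin n) // S.card = k}

/-- The state space `[0,∞)^N`, with its product topology. -/
abbrev State (n k : ℕ) : Type := Idx n k → ℝ≥0

section Flow

variable {Ω : Type*} {n k : ℕ}

/-- The likelihood ratio `L^i_t = exp (μ ∑_{j ∈ i} B^j_t - k (μ² / 2) t)`. -/
def likelihood (mu : ℝ) (B : Fin n → ℝ≥0 → Ω → ℝ) (i : Idx n k) (t : ℝ≥0) (ω : Ω) : ℝ :=
  Real.exp (mu * ∑ j ∈ i.1, B j t ω - k * (mu ^ 2 / 2) * t)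

/-- `e^{λ t} L^i_t (φ_i + λ ∫₀ᵗ ds / (e^{λ s} L^i_s))` as a real number. -/
def ratioReal (mu lam : ℝ) (B : Fin n → ℝ≥0 → Ω → ℝ) (φ : State n k) (i : Idx n k)
    (t : ℝ≥0) (ω : Ω) : ℝ :=
  Real.exp (lam * t) * likelihood mu B i t ω *
    (φ i + lam * ∫ s in (0 : ℝ)..t, 1 / (Real.exp (lam * s) * likelihood mu B i s.toNNReal ω))

/-- The posterior ratio process `Φ` started at `φ`, with values in `[0,∞)^N`. -/
def ratio (mu lam : ℝ) (B : Fin n → ℝ≥0 → Ω → ℝ) (φ : State n k) (t : ℝ≥0) (ω : Ω) :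
    State n k :=
  fun i => (ratioReal mu lam B φ i t ω).toNNReal

/-- The truncation in `ratio` is never active. -/
lemma coe_ratio (mu lam : ℝ) (hlam : 0 ≤ lam) (B : Fin n → ℝ≥0 → Ω → ℝ) (φ : State n k)
    (t : ℝ≥0) (ω : Ω) (i : Idx n k) :
    (ratio mu lam B φ t ω i : ℝ) = ratioReal mu lam B φ i t ω := by
  refine Real.coe_toNNReal _ (mul_nonneg ?_ (add_nonneg (φ i).2 (mul_nonneg hlam ?_)))
  · unfold likelihood; positivity
  · refine intervalIntegral.integral_nonneg t.2 fun s _ => ?_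
    unfold likelihood; positivity

/-- `τ` is a stopping time of the process `Y`, that is, with respect to the natural filtration
`σ(Y_s | 0 ≤ s ≤ t)` of `Y`; the value `∞` is allowed. -/
def IsStoppingTimeOf {E : Type*} [MeasurableSpace E] (Y : ℝ≥0 → Ω → E) (τ : Ω → ℝ≥0∞) : Prop :=
  ∀ t : ℝ≥0, MeasurableSet[⨆ s ≤ t, MeasurableSpace.comap (Y s) inferInstance] {ω | τ ω ≤ t}

/-- For a measurable process this is Mathlib's notion for Mathlib's natural filtration. -/
lemma isStoppingTimeOf_iff [MeasurableSpace Ω] (Y : ℝ≥0 → Ω → State n k)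
    (hY : ∀ t, StronglyMeasurable (Y t)) (τ : Ω → ℝ≥0∞) :
    IsStoppingTimeOf Y τ ↔ IsStoppingTime (Filtration.natural Y hY) τ :=
  Iff.rfl

/-- The first hitting time `σ_A = inf {t > 0 | Y_t ∈ A}` (with `inf ∅ = ∞`). -/
def hittingTime {E : Type*} (Y : ℝ≥0 → Ω → E) (A : Set E) (ω : Ω) : ℝ≥0∞ :=
  ⨅ (t : ℝ≥0) (_ : 0 < t ∧ Y t ω ∈ A), (t : ℝ≥0∞)

variable [MeasurableSpace Ω]

/-- `E_φ [∫₀^τ e^{-λ t} (∑_i p_i Φ^i_t - λ / c) dt]`, as an extended real number. The integrand is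
the difference of two nonnegative terms; the second has finite integral (at most `1 / c`), and the
first may have integral `+∞`. -/
def expectedCost (mu lam c : ℝ) (p : Idx n k → ℝ) (B : Fin n → ℝ≥0 → Ω → ℝ) (P : Measure Ω)
    (φ : State n k) (τ : Ω → ℝ≥0∞) : EReal :=
  ((∫⁻ ω, (∫⁻ t in {t : ℝ | 0 < t ∧ ENNReal.ofReal t < τ ω},
      ENNReal.ofReal (Real.exp (-lam * t) *
        ∑ i, p i * (ratio mu lam B φ t.toNNReal ω i : ℝ))) ∂P : ℝ≥0∞) : EReal) -
  ((∫⁻ ω, (∫⁻ t in {t : ℝ | 0 < t ∧ ENNReal.ofReal t < τ ω},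
      ENNReal.ofReal (Real.exp (-lam * t) * (lam / c))) ∂P : ℝ≥0∞) : EReal)

/-- The value function: the infimum of the expected cost over all stopping times of `Φ`. -/
def value (mu lam c : ℝ) (p : Idx n k → ℝ) (B : Fin n → ℝ≥0 → Ω → ℝ) (P : Measure Ω)
    (φ : State n k) : EReal :=
  ⨅ (τ : Ω → ℝ≥0∞) (_ : IsStoppingTimeOf (ratio mu lam B φ) τ),
    expectedCost mu lam c p B P φ τ

/-- The continuation set `C`. -/
def continuationSet (mu lam c : ℝ) (p : Idx n k → ℝ) (B : Fin n → ℝ≥0 → Ω → ℝ)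
    (P : Measure Ω) : Set (State n k) :=
  {φ | value mu lam c p B P φ < 0}

/-- The stopping set `D`. -/
def stoppingSet (mu lam c : ℝ) (p : Idx n k → ℝ) (B : Fin n → ℝ≥0 → Ω → ℝ)
    (P : Measure Ω) : Set (State n k) :=
  {φ | value mu lam c p B P φ = 0}

/-- `φ` is probabilistically regular for `A`: started at `φ`, the process `Φ` satisfies
`σ_A = 0` with probability one. -/
def IsRegularFor (mu lam : ℝ) (B : Fin n → ℝ≥0 → Ω → ℝ) (P : Measure Ω)
    (A : Set (State n k)) (φ : State n k) : Prop :=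
  ∀ᵐ ω ∂P, hittingTime (ratio mu lam B φ) A ω = 0

end Flow

end QuickestDetection

end

/-!
The continuation set `C` is open. The natural filtration of `Φ` does not depend on its starting
point: if `A` is the clock of the positive path `y = e^{λ t} L^i`, then `Φ^i = y A` determines `A`
through `(log A)' = λ / (y A)`, hence also `y`. A stopping time that is strictly profitable from
`φ` may therefore be used from a nearby `ψ`, and truncating it at a bounded time keeps it
profitable: the discounted running cost is affine in the starting point with slopes `p_i L^i`, and
`E L^i = 1`. For the same reason the expected cost of each stopping time increases with the starting
point, so the stopping set `D` is an upper set; it contains `∂C` because `C` is open.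

It remains to see that `Φ` returns above its starting point `φ` at arbitrarily small times, and it
does so whenever `μ B^j_t ≥ (μ² / 2) t` for all `j`, since then `L^i_t ≥ 1`. By time inversion this
asks for arbitrarily large times at which all coordinates of a Brownian motion exceed a given
level. Along very sparse times the increments are independent and are jointly large infinitely
often by the second Borel–Cantelli lemma, while the past is negligible by the first.
-/

namespace QuickestDetection

open Filter Topology

/-! ### Joint excursions of independent Brownian motions -/

section Gaussian

variable {Ω : Type*} [MeasurableSpace Ω] {P : Measure Ω} {X : Ω → ℝ} {v : ℝ≥0}

lemma measure_sqrt_variance_le_of_hasLaw_gaussianReal (hX : HasLaw X (gaussianReal 0 v) P)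
    (hv : v ≠ 0) : P {ω | √v ≤ X ω} = gaussianReal 0 1 (Set.Ici 1) := by
  have hsqrt : 0 < √(v : ℝ) := by positivity
  have hZ : HasLaw (fun ω => (√(v : ℝ))⁻¹ * X ω) (gaussianReal 0 1) P := by
    convert gaussianReal_const_mul hX (√(v : ℝ))⁻¹ using 2
    · rw [mul_zero]
    · ext
      simp [hv]
  rw [← hZ.map_eq, Measure.map_apply_of_aemeasurable hZ.aemeasurable measurableSet_Ici]
  congr 1
  ext ω
  simp only [Set.mem_ofPred_eq, Set.mem_preimage, Set.mem_Ici]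
  rw [inv_mul_eq_div, one_le_div hsqrt]

lemma gaussianReal_Ici_ne_zero (a : ℝ) : gaussianReal 0 1 (Set.Ici a) ≠ 0 := fun h => by
  simpa using gaussianReal_absolutelyContinuous' 0 one_ne_zero h

lemma measure_le_abs_le_of_hasLaw_gaussianReal [IsProbabilityMeasure P]
    (hX : HasLaw X (gaussianReal 0 v) P) {a : ℝ} (ha : 0 < a) :
    P {ω | a ≤ |X ω|} ≤ ENNReal.ofReal (v / a ^ 2) := by
  have h := meas_ge_le_variance_div_sq hX.hasGaussianLaw.memLp_two ha
  rw [hX.integral_eq, hX.variance_eq, integral_id_gaussianReal, variance_id_gaussianReal] at h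
  simpa only [sub_zero] using h

end Gaussian

lemma ae_frequently_forall_mem_of_iIndepFun {Ω ι E : Type*} [MeasurableSpace Ω] [MeasurableSpace E]
    [Finite ι] {P : Measure Ω} {Y : ι × ℕ → Ω → E} (hY : iIndepFun Y P)
    (hmeas : ∀ q, Measurable (Y q)) {S : ι × ℕ → Set E} (hS : ∀ q, MeasurableSet (S q))
    {r : ℝ≥0∞} (hr : r ≠ 0) (hle : ∀ q, r ≤ P (Y q ⁻¹' S q)) :
    ∀ᵐ ω ∂P, ∃ᶠ m in atTop, ∀ j, Y (j, m) ω ∈ S (j, m) := by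
  have := hY.isProbabilityMeasure
  cases nonempty_fintype ι
  let A (m : ℕ) : Set Ω := ⋂ j, Y (j, m) ⁻¹' S (j, m)
  have hA (m : ℕ) : MeasurableSet (A m) := .iInter fun j => hmeas _ (hS _)
  have hprod (s : Finset ℕ) :
      P (⋂ m ∈ s, A m) = ∏ m ∈ s, ∏ j, P (Y (j, m) ⁻¹' S (j, m)) := by
    rw [← Finset.prod_product_right Finset.univ s fun q => P (Y q ⁻¹' S q),
      ← hY.measure_inter_preimage_eq_mul _ fun q _ => hS q]
    congr 1
    ext ω
    simp only [A, Set.mem_iInter, Finset.mem_product, Finset.mem_univ, true_and, Prod.forall]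
    exact ⟨fun h j m hm => h m hm j, fun h m hm j => h j m hm⟩
  have hA_eq (m : ℕ) : P (A m) = ∏ j, P (Y (j, m) ⁻¹' S (j, m)) := by
    simpa using hprod {m}
  have hindep : iIndepSet A P := by
    rw [iIndepSet_iff_meas_biInter hA]
    simpa only [hA_eq] using hprod
  have hsum : ∑' m, P (A m) = ∞ := by
    refine top_unique ((ENNReal.tsum_const_eq_top_of_ne_zero
      (pow_ne_zero (Fintype.card ι) hr)).symm.trans_le (ENNReal.tsum_le_tsum fun m => ?_))
    rw [hA_eq, ← Finset.card_univ]
    exact Finset.pow_card_le_prod _ _ _ fun j _ => hle (j, m)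
  have hlimsup : limsup A atTop ∈ ae P :=
    (mem_ae_iff_prob_eq_one (.measurableSet_limsup hA)).2 (measure_limsup_eq_one hA hindep hsum)
  filter_upwards [hlimsup] with ω hω
  simpa only [A, Set.mem_iInter, Set.mem_preimage] using mem_limsup_iff_frequently_mem.1 hω

section Excursion

variable {Ω ι : Type*} [MeasurableSpace Ω] {P : Measure Ω} {W : ι → ℝ≥0 → Ω → ℝ} {t : ℕ → ℝ≥0}

lemma iIndepFun_increments (hW : ∀ j, IsPreBrownianReal (W j) P)
    (hindep : iIndepFun (fun j ω s => W j s ω) P) (hmeas : ∀ j s, Measurable (W j s))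
    (ht : Monotone t) :
    iIndepFun (fun (q : ι × ℕ) ω => W q.1 (t (q.2 + 1)) ω - W q.1 (t q.2) ω) P := by
  refine iIndepFun_uncurry' (X := fun j m ω => W j (t (m + 1)) ω - W j (t m) ω)
    (fun j m => (hmeas j _).sub (hmeas j _)) ?_ fun j => (hW j).hasIndepIncrements.nat ht
  exact hindep.comp (fun _ (x : ℝ≥0 → ℝ) (m : ℕ) => x (t (m + 1)) - x (t m)) fun _ => by fun_prop

lemma ae_frequently_forall_sqrt_le_increment [Finite ι] (hW : ∀ j, IsPreBrownianReal (W j) P)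
    (hindep : iIndepFun (fun j ω s => W j s ω) P) (hmeas : ∀ j s, Measurable (W j s))
    (ht : StrictMono t) :
    ∀ᵐ ω ∂P, ∃ᶠ m in atTop, ∀ j,
      √(nndist (t (m + 1)) (t m)) ≤ W j (t (m + 1)) ω - W j (t m) ω := by
  refine ae_frequently_forall_mem_of_iIndepFun
    (S := fun q => Set.Ici √(nndist (t (q.2 + 1)) (t q.2)))
    (iIndepFun_increments hW hindep hmeas ht.monotone)
    (fun q => (hmeas _ _).sub (hmeas _ _)) (fun _ => measurableSet_Ici)
    (gaussianReal_Ici_ne_zero 1) fun q => Eq.ge ?_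
  refine measure_sqrt_variance_le_of_hasLaw_gaussianReal ((hW q.1).hasLaw_sub _ _) ?_
  exact nndist_eq_zero.not.2 (ht (Nat.lt_succ_self q.2)).ne'

lemma ae_eventually_abs_lt_half_sqrt {X : ℝ≥0 → Ω → ℝ} [IsProbabilityMeasure P]
    (hX : IsPreBrownianReal X P) (ht : StrictMono t)
    (hsum : Summable fun m => (t m : ℝ) / nndist (t (m + 1)) (t m)) :
    ∀ᵐ ω ∂P, ∀ᶠ m in atTop, |X (t m) ω| < √(nndist (t (m + 1)) (t m)) / 2 := by
  have hlarge (m : ℕ) : P {ω | √(nndist (t (m + 1)) (t m)) / 2 ≤ |X (t m) ω|} ≤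
      ENNReal.ofReal (4 * (t m / nndist (t (m + 1)) (t m))) := by
    have hgap : (0 : ℝ) < nndist (t (m + 1)) (t m) :=
      dist_pos.2 (ht (Nat.lt_succ_self m)).ne'
    convert measure_le_abs_le_of_hasLaw_gaussianReal (hX.hasLaw_eval (t m))
      (half_pos (Real.sqrt_pos.2 hgap)) using 2
    rw [div_pow, Real.sq_sqrt hgap.le]
    ring
  filter_upwards [ae_eventually_notMem (ne_top_of_le_ne_top
    (hsum.mul_left 4).tsum_ofReal_ne_top (ENNReal.tsum_le_tsum hlarge))] with ω hω
  simpa only [Set.mem_ofPred_eq, not_le] using hω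

lemma ae_frequently_forall_half_sqrt_le [Finite ι] (hW : ∀ j, IsPreBrownianReal (W j) P)
    (hindep : iIndepFun (fun j ω s => W j s ω) P) (hmeas : ∀ j s, Measurable (W j s))
    (ht : StrictMono t) (hsum : Summable fun m => (t m : ℝ) / nndist (t (m + 1)) (t m)) :
    ∀ᵐ ω ∂P, ∃ᶠ m in atTop, ∀ j, √(nndist (t (m + 1)) (t m)) / 2 ≤ W j (t (m + 1)) ω := by
  have := hindep.isProbabilityMeasure
  filter_upwards [ae_frequently_forall_sqrt_le_increment hW hindep hmeas ht,
    ae_all_iff.2 fun j => ae_eventually_abs_lt_half_sqrt (hW j) ht hsum] with ω hincr hpast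
  refine (hincr.and_eventually (eventually_all.2 hpast)).mono fun m ⟨hm, hlt⟩ j => ?_
  linarith [hm j, (abs_lt.1 (hlt j)).1]

/-- The squared factorials: a sequence of times whose gaps dominate the time elapsed before, so
that along it the increments of a Brownian motion dominate its past. -/
def sparseTime (m : ℕ) : ℝ≥0 := ((m + 1).factorial : ℝ≥0) ^ 2

lemma sparseTime_pos (m : ℕ) : 0 < sparseTime m := by
  unfold sparseTime
  positivity

lemma sparseTime_succ (m : ℕ) :
    sparseTime (m + 1) = sparseTime m + sparseTime m * ((m + 1) * (m + 3)) := by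
  unfold sparseTime
  rw [Nat.factorial_succ (m + 1)]
  push_cast
  ring

lemma strictMono_sparseTime : StrictMono sparseTime :=
  strictMono_nat_of_lt_succ fun m => by
    rw [sparseTime_succ]
    exact lt_add_of_pos_right _ (mul_pos (sparseTime_pos m) (by positivity))

lemma nndist_sparseTime (m : ℕ) :
    nndist (sparseTime (m + 1)) (sparseTime m) = sparseTime m * ((m + 1) * (m + 3)) := by
  rw [sparseTime_succ, NNReal.nndist_eq, add_tsub_cancel_left, tsub_eq_zero_of_le le_self_add,
    max_eq_left zero_le]

lemma natCast_le_sparseTime (m : ℕ) : (m : ℝ≥0) ≤ sparseTime m := by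
  have h : m ≤ (m + 1).factorial ^ 2 :=
    (Nat.le_succ m).trans ((Nat.self_le_factorial _).trans (Nat.le_self_pow two_ne_zero _))
  unfold sparseTime
  exact_mod_cast h

lemma summable_sparseTime_div_nndist :
    Summable fun m => (sparseTime m : ℝ) / nndist (sparseTime (m + 1)) (sparseTime m) := by
  have hsq : Summable fun m : ℕ => 1 / ((m : ℝ) + 1) ^ 2 := by
    exact_mod_cast (summable_nat_add_iff 1).2 (Real.summable_one_div_nat_pow.2 one_lt_two)
  refine hsq.of_nonneg_of_le (fun m => by positivity) fun m => ?_
  have hpos : (0 : ℝ) < sparseTime m := sparseTime_pos m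
  rw [nndist_sparseTime]
  push_cast
  rw [div_mul_cancel_left₀ hpos.ne', ← one_div]
  gcongr
  nlinarith

lemma tendsto_nndist_sparseTime :
    Tendsto (fun m => (nndist (sparseTime (m + 1)) (sparseTime m) : ℝ)) atTop atTop := by
  refine tendsto_atTop_mono (fun m => ?_) tendsto_natCast_atTop_atTop
  have h : (m : ℝ≥0) ≤ nndist (sparseTime (m + 1)) (sparseTime m) := by
    rw [nndist_sparseTime]
    refine (natCast_le_sparseTime m).trans (le_mul_of_one_le_right zero_le ?_)
    exact_mod_cast Nat.one_le_iff_ne_zero.2 (by positivity : (m + 1) * (m + 3) ≠ 0)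
  exact_mod_cast h

lemma ae_frequently_atTop_forall_le [Finite ι] (hW : ∀ j, IsPreBrownianReal (W j) P)
    (hindep : iIndepFun (fun j ω s => W j s ω) P) (hmeas : ∀ j s, Measurable (W j s)) (a : ℝ) :
    ∀ᵐ ω ∂P, ∃ᶠ s in atTop, ∀ j, a ≤ W j s ω := by
  have htime : Tendsto (fun m => sparseTime (m + 1)) atTop atTop :=
    (tendsto_atTop_mono natCast_le_sparseTime tendsto_natCast_atTop_atTop).comp
      (tendsto_add_atTop_nat 1)
  have hlevel : ∀ᶠ m in atTop, a ≤ √(nndist (sparseTime (m + 1)) (sparseTime m)) / 2 :=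
    ((Real.tendsto_sqrt_atTop.comp tendsto_nndist_sparseTime).atTop_div_const
      two_pos).eventually_ge_atTop a
  filter_upwards [ae_frequently_forall_half_sqrt_le hW hindep hmeas strictMono_sparseTime
    summable_sparseTime_div_nndist] with ω hω
  exact htime.frequently ((hω.and_eventually hlevel).mono fun m hm j => hm.2.trans (hm.1 j))

lemma ae_frequently_nhdsGT_zero_forall_mul_le [Finite ι] (hW : ∀ j, IsPreBrownianReal (W j) P)
    (hindep : iIndepFun (fun j ω s => W j s ω) P) (hmeas : ∀ j s, Measurable (W j s)) (a : ℝ) :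
    ∀ᵐ ω ∂P, ∃ᶠ s in 𝓝[>] (0 : ℝ≥0), ∀ j, a * s ≤ W j s ω := by
  have hindep_inv : iIndepFun (fun j ω (s : ℝ≥0) => (s : ℝ) * W j (1 / s) ω) P :=
    hindep.comp (fun _ (x : ℝ≥0 → ℝ) (s : ℝ≥0) => (s : ℝ) * x (1 / s)) fun _ => by fun_prop
  filter_upwards [ae_frequently_atTop_forall_le (fun j => (hW j).inv) hindep_inv
    (fun j s => (hmeas j _).const_mul _) a] with ω hω
  refine tendsto_inv_atTop_nhdsGT_zero.frequently
    ((hω.and_eventually (eventually_gt_atTop 0)).mono fun s ⟨hs, hpos⟩ j => ?_)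
  have hpos' : (0 : ℝ) < s := hpos
  rw [NNReal.coe_inv, ← div_eq_mul_inv, div_le_iff₀' hpos', ← one_div]
  exact hs j

end Excursion

/-! ### Recovering a path from its product with its clock -/

lemma measurable_intervalIntegral_of_continuousOn {Ω : Type*} [MeasurableSpace Ω] {f : ℝ → Ω → ℝ}
    {a b : ℝ} (hab : a ≤ b) (hc : ∀ ω, ContinuousOn (fun s => f s ω) (Set.Icc a b))
    (hm : ∀ s ∈ Set.Icc a b, Measurable (f s)) : Measurable fun ω => ∫ s in a..b, f s ω := by
  have hcont (ω : Ω) : Continuous fun s => f (Set.projIcc a b hab s) ω :=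
    (continuousOn_iff_continuous_domRestrict.1 (hc ω)).comp continuous_projIcc
  have hmeas : Measurable (Function.uncurry fun s ω => f (Set.projIcc a b hab s) ω) :=
    measurable_uncurry_of_continuous_of_measurable hcont fun s => hm _ (Set.projIcc a b hab s).2
  have heq : (fun ω => ∫ s in a..b, f s ω) =
      fun ω => ∫ s in Set.Ioc a b, f (Set.projIcc a b hab s) ω := by
    ext ω
    rw [intervalIntegral.integral_of_le hab]
    refine setIntegral_congr_fun measurableSet_Ioc fun s hs => ?_
    rw [Set.projIcc_of_mem hab (Set.Ioc_subset_Icc_self hs)]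
  rw [heq]
  exact hmeas.stronglyMeasurable.integral_prod_left.measurable

/-- The clock `A_t = φ + λ ∫₀ᵗ ds / y_s` of a positive path `y`, the nondecreasing factor of the
posterior ratio `y_t A_t` started at `φ`. -/
noncomputable def clock (lam φ : ℝ) (y : ℝ → ℝ) (t : ℝ) : ℝ := φ + lam * ∫ s in (0 : ℝ)..t, 1 / y s

section Path

variable {y : ℝ → ℝ} {lam φ : ℝ}

lemma clock_zero : clock lam φ y 0 = φ := by simp [clock]

lemma hasDerivAt_clock (hy : Continuous y) (hpos : ∀ s, 0 < y s) (t : ℝ) :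
    HasDerivAt (clock lam φ y) (lam * (1 / y t)) t := by
  have hc : Continuous fun s => 1 / y s := continuous_const.div hy fun s => (hpos s).ne'
  exact ((hc.integral_hasStrictDerivAt 0 t).hasDerivAt.const_mul lam).const_add φ

lemma continuous_clock (hy : Continuous y) (hpos : ∀ s, 0 < y s) : Continuous (clock lam φ y) :=
  continuous_iff_continuousAt.2 fun t => (hasDerivAt_clock hy hpos t).continuousAt

lemma le_clock (hpos : ∀ s, 0 < y s) (hlam : 0 ≤ lam) {t : ℝ} (ht : 0 ≤ t) :
    φ ≤ clock lam φ y t :=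
  le_add_of_nonneg_right (mul_nonneg hlam
    (intervalIntegral.integral_nonneg ht fun s _ => (one_div_pos.2 (hpos s)).le))

lemma clock_pos (hy : Continuous y) (hpos : ∀ s, 0 < y s) (hlam : 0 < lam) (hφ : 0 ≤ φ) {t : ℝ}
    (ht : 0 < t) : 0 < clock lam φ y t := by
  have hc : Continuous fun s => 1 / y s := continuous_const.div hy fun s => (hpos s).ne'
  refine add_pos_of_nonneg_of_pos hφ (mul_pos hlam ?_)
  exact intervalIntegral.intervalIntegral_pos_of_pos (hc.intervalIntegrable _ _)
    (fun s => one_div_pos.2 (hpos s)) ht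

-- The logarithmic derivative `λ / (y A)` of the clock `A` involves only the product `y A`.
lemma clock_eq_mul_exp_integral (hy : Continuous y) (hpos : ∀ s, 0 < y s) (hlam : 0 < lam)
    (hφ : 0 ≤ φ) {s t : ℝ} (hs : 0 < s) (hst : s ≤ t) :
    clock lam φ y t =
      clock lam φ y s * Real.exp (∫ r in s..t, lam / (y r * clock lam φ y r)) := by
  have hA (r : ℝ) (hr : r ∈ Set.uIcc s t) : 0 < clock lam φ y r := by
    rw [Set.uIcc_of_le hst] at hr
    exact clock_pos hy hpos hlam hφ (hs.trans_le hr.1)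
  have hlog (r : ℝ) (hr : r ∈ Set.uIcc s t) : HasDerivAt (fun r => Real.log (clock lam φ y r))
      (lam / (y r * clock lam φ y r)) r := by
    simpa only [mul_one_div, div_div] using (hasDerivAt_clock hy hpos r).log (hA r hr).ne'
  have hint := intervalIntegral.integral_eq_sub_of_hasDerivAt hlog
    (continuousOn_const.div (hy.mul (continuous_clock hy hpos)).continuousOn
      fun r hr => (mul_pos (hpos r) (hA r hr)).ne').intervalIntegrable
  have hAs := hA s Set.left_mem_uIcc
  rw [hint, Real.exp_sub, Real.exp_log (hA t Set.right_mem_uIcc), Real.exp_log hAs,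
    mul_div_cancel₀ _ hAs.ne']

lemma tendsto_affine_div_clock (hy : Continuous y) (hpos : ∀ s, 0 < y s) (hy0 : y 0 = 1)
    (hlam : 0 < lam) (hφ : 0 ≤ φ) :
    Tendsto (fun s => (φ + lam * s) / clock lam φ y s) (𝓝[>] 0) (𝓝 1) := by
  rcases hφ.eq_or_lt with rfl | hφ
  · have hslope : Tendsto (fun s => s⁻¹ * clock lam 0 y s) (𝓝[>] 0) (𝓝 lam) := by
      simpa [clock_zero, hy0] using (hasDerivAt_clock (φ := 0) hy hpos 0).tendsto_slope_zero_right
    have hquot := (tendsto_const_nhds (x := lam)).div hslope hlam.ne'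
    rw [div_self hlam.ne'] at hquot
    refine hquot.congr fun s => ?_
    rw [Pi.div_apply, zero_add, inv_mul_eq_div, div_div_eq_mul_div]
  · have hcont : ContinuousAt (fun s => (φ + lam * s) / clock lam φ y s) 0 :=
      ContinuousAt.div (by fun_prop) (continuous_clock hy hpos).continuousAt
        (by rw [clock_zero]; exact hφ.ne')
    have hlim := hcont.tendsto
    rw [clock_zero, mul_zero, add_zero, div_self hφ.ne'] at hlim
    exact hlim.mono_left nhdsWithin_le_nhds

lemma tendsto_affine_mul_exp_integral (hy : Continuous y) (hpos : ∀ s, 0 < y s) (hy0 : y 0 = 1)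
    (hlam : 0 < lam) (hφ : 0 ≤ φ) {t : ℝ} (ht : 0 < t) :
    Tendsto (fun s => (φ + lam * s) * Real.exp (∫ r in s..t, lam / (y r * clock lam φ y r)))
      (𝓝[>] 0) (𝓝 (clock lam φ y t)) := by
  have h := (tendsto_affine_div_clock hy hpos hy0 hlam hφ).mul_const (clock lam φ y t)
  rw [one_mul] at h
  refine h.congr' ?_
  filter_upwards [Ioo_mem_nhdsGT ht] with s hs
  rw [clock_eq_mul_exp_integral hy hpos hlam hφ hs.1 hs.2.le, ← mul_assoc,
    div_mul_cancel₀ _ (clock_pos hy hpos hlam hφ hs.1).ne']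

end Path

section PathMeasurability

variable {Ω : Type*} [MeasurableSpace Ω] {y : ℝ → Ω → ℝ} {lam φ t : ℝ}

lemma measurable_clock (hy : ∀ ω, Continuous fun s => y s ω) (hpos : ∀ s ω, 0 < y s ω)
    (ht : 0 ≤ t) (hmeas : ∀ s ∈ Set.Icc 0 t, Measurable (y s)) :
    Measurable fun ω => clock lam φ (y · ω) t := by
  refine measurable_const.add (measurable_const.mul
    (measurable_intervalIntegral_of_continuousOn ht (fun ω => ?_)
      fun s hs => measurable_const.div (hmeas s hs)))
  exact (continuous_const.div (hy ω) fun s => (hpos s ω).ne').continuousOn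

lemma measurable_clock_of_measurable_mul_clock (hy : ∀ ω, Continuous fun s => y s ω)
    (hpos : ∀ s ω, 0 < y s ω) (hy0 : ∀ ω, y 0 ω = 1) (hlam : 0 < lam) (hφ : 0 ≤ φ) (ht : 0 < t)
    (hmeas : ∀ s ∈ Set.Ioc 0 t, Measurable fun ω => y s ω * clock lam φ (y · ω) s) :
    Measurable fun ω => clock lam φ (y · ω) t := by
  obtain ⟨u, -, hu_mem, hu⟩ := exists_seq_strictAnti_tendsto' ht
  have hu' : Tendsto u atTop (𝓝[>] 0) :=
    tendsto_nhdsWithin_iff.2 ⟨hu, .of_forall fun m => (hu_mem m).1⟩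
  refine measurable_of_tendsto_metrizable (f := fun m ω => (φ + lam * u m) *
    Real.exp (∫ r in u m..t, lam / (y r ω * clock lam φ (y · ω) r))) (fun m => ?_) ?_
  · refine measurable_const.mul (Real.measurable_exp.comp
      (measurable_intervalIntegral_of_continuousOn (hu_mem m).2.le (fun ω => ?_) fun s hs =>
        measurable_const.div (hmeas s ⟨(hu_mem m).1.trans_le hs.1, hs.2⟩)))
    refine continuousOn_const.div
      ((hy ω).mul (continuous_clock (hy ω) fun s => hpos s ω)).continuousOn fun s hs => ?_
    exact (mul_pos (hpos s ω) (clock_pos (hy ω) (fun s => hpos s ω) hlam hφ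
      ((hu_mem m).1.trans_le hs.1))).ne'
  · exact tendsto_pi_nhds.2 fun ω => (tendsto_affine_mul_exp_integral (hy ω)
      (fun s => hpos s ω) (hy0 ω) hlam hφ ht).comp hu'

lemma measurable_of_measurable_mul_clock (hy : ∀ ω, Continuous fun s => y s ω)
    (hpos : ∀ s ω, 0 < y s ω) (hy0 : ∀ ω, y 0 ω = 1) (hlam : 0 < lam) (hφ : 0 ≤ φ) (ht : 0 ≤ t)
    (hmeas : ∀ s ∈ Set.Ioc 0 t, Measurable fun ω => y s ω * clock lam φ (y · ω) s) :
    Measurable (y t) := by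
  rcases ht.eq_or_lt with rfl | ht
  · rw [funext hy0]
    exact measurable_const
  · have hquot (ω : Ω) : y t ω = y t ω * clock lam φ (y · ω) t / clock lam φ (y · ω) t :=
      (mul_div_cancel_right₀ _ (clock_pos (hy ω) (fun s => hpos s ω) hlam hφ ht).ne').symm
    rw [funext hquot]
    exact (hmeas t ⟨ht, le_rfl⟩).div
      (measurable_clock_of_measurable_mul_clock hy hpos hy0 hlam hφ ht hmeas)

end PathMeasurability

/-! ### The posterior ratio process and its stopping times -/

section Ratio

variable {Ω : Type*} {n k : ℕ} {mu lam : ℝ} {B : Fin n → ℝ≥0 → Ω → ℝ}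

lemma likelihood_pos (i : Idx n k) (t : ℝ≥0) (ω : Ω) : 0 < likelihood mu B i t ω :=
  Real.exp_pos _

lemma likelihood_eq_prod (i : Idx n k) (t : ℝ≥0) (ω : Ω) :
    likelihood mu B i t ω = ∏ j ∈ i.1, Real.exp (mu * B j t ω - mu ^ 2 / 2 * t) := by
  rw [likelihood, ← Real.exp_sum, Finset.sum_sub_distrib, Finset.mul_sum, Finset.sum_const, i.2,
    nsmul_eq_mul, mul_assoc (k : ℝ)]

lemma continuous_likelihood (hc : ∀ j ω, Continuous fun t => B j t ω) (i : Idx n k) (ω : Ω) :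
    Continuous fun t => likelihood mu B i t ω := by
  unfold likelihood
  fun_prop

/-- The growth factor `e^{λ t} L^i_t` of the posterior ratio, extended to negative times, where
`L^i` is frozen at its initial value. -/
noncomputable def growth (mu lam : ℝ) (B : Fin n → ℝ≥0 → Ω → ℝ) (i : Idx n k) (t : ℝ) (ω : Ω) : ℝ :=
  Real.exp (lam * t) * likelihood mu B i t.toNNReal ω

lemma growth_pos (i : Idx n k) (t : ℝ) (ω : Ω) : 0 < growth mu lam B i t ω :=
  mul_pos (Real.exp_pos _) (likelihood_pos i _ ω)

lemma growth_zero (h0 : ∀ j ω, B j 0 ω = 0) (i : Idx n k) (ω : Ω) :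
    growth mu lam B i 0 ω = 1 := by
  simp [growth, likelihood, h0]

lemma continuous_growth (hc : ∀ j ω, Continuous fun t => B j t ω) (i : Idx n k) (ω : Ω) :
    Continuous fun t => growth mu lam B i t ω :=
  Continuous.mul (by fun_prop) ((continuous_likelihood hc i ω).comp continuous_real_toNNReal)

lemma exp_neg_mul_growth (i : Idx n k) (t : ℝ) (ω : Ω) :
    Real.exp (-lam * t) * growth mu lam B i t ω = likelihood mu B i t.toNNReal ω := by
  rw [growth, ← mul_assoc, ← Real.exp_add, neg_mul, neg_add_cancel, Real.exp_zero, one_mul]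

lemma ratioReal_eq_growth_mul_clock (φ : State n k) (i : Idx n k) (t : ℝ≥0) (ω : Ω) :
    ratioReal mu lam B φ i t ω =
      growth mu lam B i t ω * clock lam (φ i) (growth mu lam B i · ω) t := by
  rw [growth, Real.toNNReal_coe]
  rfl

lemma coe_ratio_toNNReal (hlam : 0 ≤ lam) (φ : State n k) (i : Idx n k) {t : ℝ} (ht : 0 ≤ t)
    (ω : Ω) : (ratio mu lam B φ t.toNNReal ω i : ℝ) =
      growth mu lam B i t ω * clock lam (φ i) (growth mu lam B i · ω) t := by
  rw [coe_ratio mu lam hlam, ratioReal_eq_growth_mul_clock, Real.coe_toNNReal t ht]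

lemma coe_ratio_toNNReal_eq_add (hlam : 0 ≤ lam) (φ ψ : State n k) (i : Idx n k) {t : ℝ}
    (ht : 0 ≤ t) (ω : Ω) : (ratio mu lam B ψ t.toNNReal ω i : ℝ) =
      ratio mu lam B φ t.toNNReal ω i + growth mu lam B i t ω * (ψ i - φ i) := by
  rw [coe_ratio_toNNReal hlam ψ i ht, coe_ratio_toNNReal hlam φ i ht, clock, clock]
  ring

lemma le_ratio_of_forall_le (hlam : 0 ≤ lam) (φ : State n k) {t : ℝ≥0} {ω : Ω}
    (h : ∀ j, mu ^ 2 / 2 * t ≤ mu * B j t ω) : φ ≤ ratio mu lam B φ t ω := by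
  intro i
  have hlikelihood : 1 ≤ likelihood mu B i t ω := by
    rw [likelihood_eq_prod, ← Real.exp_sum]
    exact Real.one_le_exp (Finset.sum_nonneg fun j _ => sub_nonneg.2 (h j))
  have hgrowth : 1 ≤ growth mu lam B i t ω := by
    rw [growth, Real.toNNReal_coe]
    exact one_le_mul_of_one_le_of_one_le (Real.one_le_exp (by positivity)) hlikelihood
  have hclock : (φ i : ℝ) ≤ clock lam (φ i) (growth mu lam B i · ω) t :=
    le_clock (fun s => growth_pos i s ω) hlam t.coe_nonneg
  rw [← NNReal.coe_le_coe, coe_ratio mu lam hlam, ratioReal_eq_growth_mul_clock]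
  exact hclock.trans (le_mul_of_one_le_left ((φ i).coe_nonneg.trans hclock) hgrowth)

section Measurability

variable [MeasurableSpace Ω]

lemma measurable_ratio_of_measurable_growth (hc : ∀ j ω, Continuous fun t => B j t ω)
    (φ : State n k) {t : ℝ≥0}
    (h : ∀ i : Idx n k, ∀ s ∈ Set.Icc (0 : ℝ) t, Measurable (growth mu lam B i s)) :
    Measurable (ratio mu lam B φ t) := by
  refine measurable_pi_lambda _ fun i => Measurable.real_toNNReal ?_
  rw [funext (ratioReal_eq_growth_mul_clock φ i t)]
  exact (h i t ⟨t.coe_nonneg, le_rfl⟩).mul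
    (measurable_clock (continuous_growth hc i) (growth_pos i) t.coe_nonneg (h i))

lemma measurable_growth_of_measurable_ratio (hlam : 0 < lam)
    (hc : ∀ j ω, Continuous fun t => B j t ω) (h0 : ∀ j ω, B j 0 ω = 0) (φ : State n k)
    (i : Idx n k) {t : ℝ} (ht : 0 ≤ t)
    (h : ∀ s ∈ Set.Ioc 0 t, Measurable (ratio mu lam B φ s.toNNReal)) :
    Measurable (growth mu lam B i t) := by
  refine measurable_of_measurable_mul_clock (continuous_growth hc i) (growth_pos i)
    (growth_zero h0 i) hlam (φ i).coe_nonneg ht fun s hs => ?_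
  rw [← funext (coe_ratio_toNNReal hlam.le φ i hs.1.le)]
  exact ((measurable_pi_apply i).comp (h s hs)).coe_nnreal_real

end Measurability

lemma iSup_comap_ratio_le (hlam : 0 < lam) (hc : ∀ j ω, Continuous fun t => B j t ω)
    (h0 : ∀ j ω, B j 0 ω = 0) (φ ψ : State n k) (t : ℝ≥0) :
    (⨆ s ≤ t, MeasurableSpace.comap (ratio mu lam B φ s) inferInstance) ≤
      ⨆ s ≤ t, MeasurableSpace.comap (ratio mu lam B ψ s) inferInstance := by
  let m : MeasurableSpace Ω := ⨆ s ≤ t, MeasurableSpace.comap (ratio mu lam B ψ s) inferInstance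
  have hψ (s : ℝ≥0) (hs : s ≤ t) : Measurable[m] (ratio mu lam B ψ s) :=
    measurable_iff_comap_le.2 (le_iSup₂_of_le s hs le_rfl)
  refine iSup₂_le fun s hs => measurable_iff_comap_le.1 ?_
  refine measurable_ratio_of_measurable_growth hc φ fun i r hr => ?_
  refine measurable_growth_of_measurable_ratio hlam hc h0 ψ i hr.1 fun q hq => hψ _ ?_
  exact (Real.toNNReal_le_iff_le_coe.2 (hq.2.trans hr.2)).trans hs

lemma IsStoppingTimeOf.of_ratio (hlam : 0 < lam) (hc : ∀ j ω, Continuous fun t => B j t ω)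
    (h0 : ∀ j ω, B j 0 ω = 0) {φ : State n k} (ψ : State n k) {τ : Ω → ℝ≥0∞}
    (hτ : IsStoppingTimeOf (ratio mu lam B φ) τ) : IsStoppingTimeOf (ratio mu lam B ψ) τ :=
  fun t => iSup_comap_ratio_le hlam hc h0 φ ψ t _ (hτ t)

end Ratio

section StoppingTime

variable {Ω E : Type*} [MeasurableSpace E] {Y : ℝ≥0 → Ω → E}

lemma isStoppingTimeOf_zero (Y : ℝ≥0 → Ω → E) : IsStoppingTimeOf Y fun _ => 0 :=
  fun t => by simp

lemma IsStoppingTimeOf.min_const {τ : Ω → ℝ≥0∞} (hτ : IsStoppingTimeOf Y τ) (T : ℝ≥0) :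
    IsStoppingTimeOf Y fun ω => min (τ ω) T := by
  intro t
  by_cases hT : T ≤ t
  · simp [hT]
  · simpa [hT] using hτ t

end StoppingTime

/-! ### Expectations of the likelihood ratios -/

section Likelihood

variable {Ω : Type*} [MeasurableSpace Ω] {n k : ℕ} {mu : ℝ} {p : Idx n k → ℝ}
  {B : Fin n → ℝ≥0 → Ω → ℝ} {P : Measure Ω}

lemma lintegral_ofReal_exp_mul_sub_of_hasLaw_gaussianReal {X : Ω → ℝ} {v : ℝ≥0}
    (hX : HasLaw X (gaussianReal 0 v) P) (θ : ℝ) :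
    ∫⁻ ω, ENNReal.ofReal (Real.exp (θ * X ω - θ ^ 2 / 2 * v)) ∂P = 1 := by
  have hmgf : ∫ x, Real.exp (θ * x) ∂gaussianReal 0 v = Real.exp (v * θ ^ 2 / 2) := by
    simpa [mgf] using mgf_gaussianReal (X := id) (Measure.map_id (μ := gaussianReal 0 v)) θ
  rw [hX.lintegral_comp (f := fun x => ENNReal.ofReal (Real.exp (θ * x - θ ^ 2 / 2 * v)))
    (by fun_prop)]
  simp_rw [Real.exp_sub]
  rw [← ofReal_integral_eq_lintegral_ofReal ((integrable_exp_mul_gaussianReal θ).div_const _)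
    (.of_forall fun x => by positivity), integral_div, hmgf, ← Real.exp_sub]
  ring_nf
  simp

lemma lintegral_likelihood (hB : IsStandardBrownian B P) (i : Idx n k) (t : ℝ≥0) :
    ∫⁻ ω, ENNReal.ofReal (likelihood mu B i t ω) ∂P = 1 := by
  have hindep : iIndepFun
      (fun j ω => ENNReal.ofReal (Real.exp (mu * B j t ω - mu ^ 2 / 2 * t))) P :=
    hB.indep.comp (fun _ (x : ℝ≥0 → ℝ) => ENNReal.ofReal (Real.exp (mu * x t - mu ^ 2 / 2 * t)))
      fun _ => by fun_prop
  have hmeas (j : Fin n) :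
      Measurable fun ω => ENNReal.ofReal (Real.exp (mu * B j t ω - mu ^ 2 / 2 * t)) := by
    have := hB.measurable j t
    fun_prop
  simp_rw [likelihood_eq_prod, ENNReal.ofReal_prod_of_nonneg fun _ _ => (Real.exp_pos _).le]
  rw [lintegral_prod_eq_prod_lintegral_of_indepFun i.1 _ hindep hmeas]
  exact Finset.prod_eq_one fun j _ => lintegral_ofReal_exp_mul_sub_of_hasLaw_gaussianReal
    ((hB.brownian j).toIsPreBrownianReal.hasLaw_eval t) mu

lemma measurable_uncurry_likelihood (hB : IsStandardBrownian B P) (i : Idx n k) :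
    Measurable (Function.uncurry fun ω (t : ℝ) => likelihood mu B i t.toNNReal ω) := by
  have hmeas : Measurable (Function.uncurry fun t ω => likelihood mu B i t ω) := by
    refine measurable_uncurry_of_continuous_of_measurable
      (continuous_likelihood hB.continuous i) fun t => ?_
    have := hB.measurable
    unfold likelihood
    fun_prop
  exact hmeas.comp ((measurable_real_toNNReal.comp measurable_snd).prodMk measurable_fst)

lemma measurable_uncurry_sum_mul_likelihood (hB : IsStandardBrownian B P) :
    Measurable (Function.uncurry fun ω (t : ℝ) =>
      ∑ i : Idx n k, p i * likelihood mu B i t.toNNReal ω) :=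
  Finset.measurable_fun_sum _ fun i _ => (measurable_uncurry_likelihood hB i).const_mul (p i)

lemma lintegral_sum_mul_likelihood (hp : ∀ i, 0 ≤ p i) (hB : IsStandardBrownian B P) (t : ℝ) :
    ∫⁻ ω, ENNReal.ofReal (∑ i, p i * likelihood mu B i t.toNNReal ω) ∂P =
      ENNReal.ofReal (∑ i, p i) := by
  have hmeas (i : Idx n k) :
      Measurable fun ω => ENNReal.ofReal (likelihood mu B i t.toNNReal ω) :=
    ((measurable_uncurry_likelihood hB i).comp measurable_prodMk_right).ennreal_ofReal
  simp_rw [ENNReal.ofReal_sum_of_nonneg fun i _ => mul_nonneg (hp i) (likelihood_pos i _ _).le,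
    ENNReal.ofReal_mul (hp _)]
  rw [lintegral_finsetSum _ fun i _ => (hmeas i).const_mul _,
    ENNReal.ofReal_sum_of_nonneg fun i _ => hp i]
  refine Finset.sum_congr rfl fun i _ => ?_
  rw [lintegral_const_mul _ (hmeas i), lintegral_likelihood hB, mul_one]

lemma lintegral_lintegral_Ioo_sum_mul_likelihood (hp : ∀ i, 0 ≤ p i)
    (hB : IsStandardBrownian B P) (T : ℝ≥0) :
    ∫⁻ ω, (∫⁻ t in Set.Ioo (0 : ℝ) T,
      ENNReal.ofReal (∑ i, p i * likelihood mu B i t.toNNReal ω)) ∂P =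
        ENNReal.ofReal (∑ i, p i) * T := by
  have : IsProbabilityMeasure P := hB.indep.isProbabilityMeasure
  rw [lintegral_lintegral_swap
    (measurable_uncurry_sum_mul_likelihood hB).ennreal_ofReal.aemeasurable]
  simp_rw [lintegral_sum_mul_likelihood hp hB]
  rw [setLIntegral_const, Real.volume_Ioo, sub_zero, ENNReal.ofReal_coe_nnreal]

end Likelihood

/-! ### The two parts of the expected cost -/

section ExpectedIntegral

variable {Ω : Type*} [MeasurableSpace Ω] {P : Measure Ω}

/-- The expectation `E ∫₀^τ f⁺ dt` of the integral of the positive part of a random function up to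
a random time, in terms of which both halves of the expected cost are written. -/
noncomputable def expectedIntegral (P : Measure Ω) (f : Ω → ℝ → ℝ) (τ : Ω → ℝ≥0∞) : ℝ≥0∞ :=
  ∫⁻ ω, (∫⁻ t in {t : ℝ | 0 < t ∧ ENNReal.ofReal t < τ ω}, ENNReal.ofReal (f ω t)) ∂P

lemma measurableSet_pos_ofReal_lt (a : ℝ≥0∞) :
    MeasurableSet {t : ℝ | 0 < t ∧ ENNReal.ofReal t < a} :=
  measurableSet_Ioi.inter (measurableSet_lt ENNReal.measurable_ofReal measurable_const)

lemma setOf_pos_ofReal_lt_min_coe (a : ℝ≥0∞) (T : ℝ≥0) :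
    {t : ℝ | 0 < t ∧ ENNReal.ofReal t < min a T} =
      {t : ℝ | 0 < t ∧ ENNReal.ofReal t < a} ∩ Set.Ioo (0 : ℝ) T := by
  ext t
  simp only [Set.mem_ofPred_eq, Set.mem_inter_iff, Set.mem_Ioo, lt_min_iff]
  have hT (ht : 0 < t) : ENNReal.ofReal t < T ↔ t < T := by
    rw [← ENNReal.ofReal_coe_nnreal, ENNReal.ofReal_lt_ofReal_iff_of_nonneg ht.le]
  grind

lemma expectedIntegral_mono {f g : Ω → ℝ → ℝ} (hle : ∀ ω t, 0 < t → f ω t ≤ g ω t)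
    (τ : Ω → ℝ≥0∞) : expectedIntegral P f τ ≤ expectedIntegral P g τ :=
  lintegral_mono fun ω => setLIntegral_mono' (measurableSet_pos_ofReal_lt _)
    fun t ht => ENNReal.ofReal_le_ofReal (hle ω t ht.1)

lemma expectedIntegral_min_const_le_add {f g h : Ω → ℝ → ℝ}
    (hh : Measurable (Function.uncurry h)) (hle : ∀ ω t, 0 < t → f ω t ≤ g ω t + h ω t)
    (τ : Ω → ℝ≥0∞) (T : ℝ≥0) :
    expectedIntegral P f (fun ω => min (τ ω) T) ≤
      expectedIntegral P g τ + ∫⁻ ω, (∫⁻ t in Set.Ioo (0 : ℝ) T, ENNReal.ofReal (h ω t)) ∂P := by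
  rw [expectedIntegral, expectedIntegral,
    ← lintegral_add_right _ (Measurable.lintegral_prod_right hh.ennreal_ofReal)]
  refine lintegral_mono fun ω => ?_
  calc ∫⁻ t in {t : ℝ | 0 < t ∧ ENNReal.ofReal t < min (τ ω) T}, ENNReal.ofReal (f ω t)
      ≤ ∫⁻ t in {t : ℝ | 0 < t ∧ ENNReal.ofReal t < min (τ ω) T},
          (ENNReal.ofReal (g ω t) + ENNReal.ofReal (h ω t)) :=
        setLIntegral_mono' (measurableSet_pos_ofReal_lt _) fun t ht =>
          (ENNReal.ofReal_le_ofReal (hle ω t ht.1)).trans ENNReal.ofReal_add_le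
    _ = (∫⁻ t in {t : ℝ | 0 < t ∧ ENNReal.ofReal t < min (τ ω) T}, ENNReal.ofReal (g ω t)) +
          ∫⁻ t in {t : ℝ | 0 < t ∧ ENNReal.ofReal t < min (τ ω) T}, ENNReal.ofReal (h ω t) :=
        lintegral_add_right _ (hh.comp measurable_prodMk_left).ennreal_ofReal
    _ ≤ _ := by
        rw [setOf_pos_ofReal_lt_min_coe]
        exact add_le_add (lintegral_mono_set Set.inter_subset_left)
          (lintegral_mono_set Set.inter_subset_right)

lemma expectedIntegral_deterministic_le [IsProbabilityMeasure P] (f : ℝ → ℝ) (τ : Ω → ℝ≥0∞) :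
    expectedIntegral P (fun _ => f) τ ≤ ∫⁻ t in Set.Ioi 0, ENNReal.ofReal (f t) :=
  calc expectedIntegral P (fun _ => f) τ
      ≤ ∫⁻ _, (∫⁻ t in Set.Ioi 0, ENNReal.ofReal (f t)) ∂P :=
        lintegral_mono fun _ => lintegral_mono_set fun _ ht => ht.1
    _ = _ := by simp

lemma expectedIntegral_deterministic_le_min_const_add [IsProbabilityMeasure P] (f : ℝ → ℝ)
    (τ : Ω → ℝ≥0∞) (T : ℝ≥0) :
    expectedIntegral P (fun _ => f) τ ≤
      expectedIntegral P (fun _ => f) (fun ω => min (τ ω) T) +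
        ∫⁻ t in Set.Ici (T : ℝ), ENNReal.ofReal (f t) := by
  have hconst : ∫⁻ t in Set.Ici (T : ℝ), ENNReal.ofReal (f t) =
      ∫⁻ _, (∫⁻ t in Set.Ici (T : ℝ), ENNReal.ofReal (f t)) ∂P := by simp
  rw [hconst, expectedIntegral, expectedIntegral, ← lintegral_add_right _ measurable_const]
  refine lintegral_mono fun ω => ?_
  refine (lintegral_mono_set fun t ht => ?_).trans (lintegral_union_le _ _ _)
  rw [setOf_pos_ofReal_lt_min_coe]
  exact (lt_or_ge t T).imp (fun h => ⟨ht, ht.1, h⟩) id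

end ExpectedIntegral

section GainRate

variable {Ω : Type*} [MeasurableSpace Ω] {P : Measure Ω} {lam c : ℝ}

/-- The rate `e^{-λ t} λ / c` at which waiting lowers the expected cost. -/
noncomputable def gainRate (lam c t : ℝ) : ℝ := Real.exp (-lam * t) * (lam / c)

lemma lintegral_Ioi_gainRate (hlam : 0 < lam) (hc : 0 < c) (T : ℝ) :
    ∫⁻ t in Set.Ioi T, ENNReal.ofReal (gainRate lam c t) =
      ENNReal.ofReal (Real.exp (-lam * T) / c) := by
  unfold gainRate
  rw [← ofReal_integral_eq_lintegral_ofReal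
    ((integrableOn_exp_mul_Ioi (neg_lt_zero.2 hlam) T).mul_const _)
    (.of_forall fun t => by positivity),
    integral_mul_const, integral_exp_mul_Ioi (neg_lt_zero.2 hlam)]
  congr 1
  field_simp

lemma expectedIntegral_gainRate_ne_top [IsProbabilityMeasure P] (hlam : 0 < lam) (hc : 0 < c)
    (τ : Ω → ℝ≥0∞) : expectedIntegral P (fun _ => gainRate lam c) τ ≠ ∞ := by
  refine ne_top_of_le_ne_top ?_ (expectedIntegral_deterministic_le _ τ)
  rw [lintegral_Ioi_gainRate hlam hc]
  exact ENNReal.ofReal_ne_top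

lemma exists_lt_expectedIntegral_gainRate_min_const [IsProbabilityMeasure P] (hlam : 0 < lam)
    (hc : 0 < c) {τ : Ω → ℝ≥0∞} {a : ℝ≥0∞}
    (ha : a < expectedIntegral P (fun _ => gainRate lam c) τ) :
    ∃ T : ℝ≥0, a < expectedIntegral P (fun _ => gainRate lam c) fun ω => min (τ ω) T := by
  have hexponent : Tendsto (fun T : ℝ≥0 => -lam * (T : ℝ)) atTop atBot :=
    (NNReal.tendsto_coe_atTop.2 tendsto_id).const_mul_atTop_of_neg (neg_lt_zero.2 hlam)
  have htail : Tendsto (fun T : ℝ≥0 => a + ENNReal.ofReal (Real.exp (-lam * T) / c)) atTop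
      (𝓝 a) := by
    simpa using (ENNReal.tendsto_ofReal
      ((Real.tendsto_exp_atBot.comp hexponent).div_const c)).const_add a
  obtain ⟨T, hT⟩ := (htail.eventually_lt_const ha).exists
  refine ⟨T, lt_of_add_lt_add_right (hT.trans_le ?_)⟩
  rw [← lintegral_Ioi_gainRate hlam hc, setLIntegral_congr Ioi_ae_eq_Ici]
  exact expectedIntegral_deterministic_le_min_const_add _ τ T

end GainRate

section DelayRate

variable {Ω : Type*} {n k : ℕ} {mu lam : ℝ} {p : Idx n k → ℝ} {B : Fin n → ℝ≥0 → Ω → ℝ}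

/-- The discounted running cost `e^{-λ t} ∑ p_i Φ^i_t` of delay, for `Φ` started at `φ`. -/
noncomputable def delayRate (mu lam : ℝ) (p : Idx n k → ℝ) (B : Fin n → ℝ≥0 → Ω → ℝ)
    (φ : State n k) (ω : Ω) (t : ℝ) : ℝ :=
  Real.exp (-lam * t) * ∑ i, p i * (ratio mu lam B φ t.toNNReal ω i : ℝ)

lemma delayRate_eq_add (hlam : 0 ≤ lam) (φ ψ : State n k) {t : ℝ} (ht : 0 ≤ t) (ω : Ω) :
    delayRate mu lam p B ψ ω t = delayRate mu lam p B φ ω t +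
      ∑ i, p i * likelihood mu B i t.toNNReal ω * (ψ i - φ i) := by
  rw [delayRate, delayRate, Finset.mul_sum, Finset.mul_sum, ← Finset.sum_add_distrib]
  refine Finset.sum_congr rfl fun i _ => ?_
  rw [coe_ratio_toNNReal_eq_add hlam φ ψ i ht, ← exp_neg_mul_growth]
  ring

lemma delayRate_mono (hlam : 0 ≤ lam) (hp : ∀ i, 0 ≤ p i) {φ ψ : State n k} (h : φ ≤ ψ) {t : ℝ}
    (ht : 0 ≤ t) (ω : Ω) : delayRate mu lam p B φ ω t ≤ delayRate mu lam p B ψ ω t := by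
  rw [delayRate_eq_add hlam φ ψ ht]
  refine le_add_of_nonneg_right (Finset.sum_nonneg fun i _ => ?_)
  exact mul_nonneg (mul_nonneg (hp i) (likelihood_pos i _ ω).le) (sub_nonneg.2 (h i))

lemma delayRate_le_add (hlam : 0 ≤ lam) (hp : ∀ i, 0 ≤ p i) (φ ψ : State n k) {t : ℝ}
    (ht : 0 ≤ t) (ω : Ω) : delayRate mu lam p B ψ ω t ≤ delayRate mu lam p B φ ω t +
      nndist ψ φ * ∑ i, p i * likelihood mu B i t.toNNReal ω := by
  rw [delayRate_eq_add hlam φ ψ ht, mul_comm, Finset.sum_mul]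
  refine add_le_add_right (Finset.sum_le_sum fun i _ => ?_) _
  refine mul_le_mul_of_nonneg_left ?_ (mul_nonneg (hp i) (likelihood_pos i _ ω).le)
  exact (le_abs_self _).trans (dist_le_pi_dist ψ φ i)

lemma expectedIntegral_delayRate_min_const_le [MeasurableSpace Ω] {P : Measure Ω}
    (hlam : 0 ≤ lam) (hp : ∀ i, 0 ≤ p i) (hB : IsStandardBrownian B P) (φ ψ : State n k)
    (τ : Ω → ℝ≥0∞) (T : ℝ≥0) :
    expectedIntegral P (delayRate mu lam p B ψ) (fun ω => min (τ ω) T) ≤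
      expectedIntegral P (delayRate mu lam p B φ) τ +
        edist ψ φ * (ENNReal.ofReal (∑ i, p i) * T) := by
  have hmeas := measurable_uncurry_sum_mul_likelihood (mu := mu) (p := p) hB
  refine (expectedIntegral_min_const_le_add (hmeas.const_mul (nndist ψ φ : ℝ))
    (fun ω t ht => delayRate_le_add hlam hp φ ψ ht.le ω) τ T).trans_eq ?_
  simp_rw [ENNReal.ofReal_mul (NNReal.coe_nonneg _), ENNReal.ofReal_coe_nnreal, ← edist_nndist,
    lintegral_const_mul' _ _ (edist_ne_top ψ φ), lintegral_lintegral_Ioo_sum_mul_likelihood hp hB]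

end DelayRate

/-! ### The value function -/

section Value

variable {Ω : Type*} [MeasurableSpace Ω] {n k : ℕ} {mu lam c : ℝ} {p : Idx n k → ℝ}
  {B : Fin n → ℝ≥0 → Ω → ℝ} {P : Measure Ω}

lemma expectedCost_eq_sub (φ : State n k) (τ : Ω → ℝ≥0∞) :
    expectedCost mu lam c p B P φ τ =
      (expectedIntegral P (delayRate mu lam p B φ) τ : EReal) -
        (expectedIntegral P (fun _ => gainRate lam c) τ : EReal) := rfl

lemma expectedCost_neg_iff [IsProbabilityMeasure P] (hlam : 0 < lam) (hc : 0 < c)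
    (φ : State n k) (τ : Ω → ℝ≥0∞) : expectedCost mu lam c p B P φ τ < 0 ↔
      expectedIntegral P (delayRate mu lam p B φ) τ <
        expectedIntegral P (fun _ => gainRate lam c) τ := by
  rw [expectedCost_eq_sub, EReal.sub_neg, EReal.coe_ennreal_lt_coe_ennreal_iff]
  · exact Or.inr (by simpa using expectedIntegral_gainRate_ne_top hlam hc τ)
  · exact Or.inl (EReal.coe_ennreal_ne_bot _)

lemma mem_continuationSet_iff [IsProbabilityMeasure P] (hlam : 0 < lam) (hc : 0 < c)
    (φ : State n k) : φ ∈ continuationSet mu lam c p B P ↔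
      ∃ τ, IsStoppingTimeOf (ratio mu lam B φ) τ ∧
        expectedIntegral P (delayRate mu lam p B φ) τ <
          expectedIntegral P (fun _ => gainRate lam c) τ := by
  simp only [continuationSet, Set.mem_ofPred_eq, value, iInf_lt_iff, exists_prop,
    expectedCost_neg_iff hlam hc]

lemma isOpen_continuationSet (hlam : 0 < lam) (hc : 0 < c) (hp : ∀ i, 0 ≤ p i)
    (hB : IsStandardBrownian B P) : IsOpen (continuationSet mu lam c p B P) := by
  have : IsProbabilityMeasure P := hB.indep.isProbabilityMeasure
  refine isOpen_iff_mem_nhds.2 fun φ hφ => ?_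
  obtain ⟨τ, hτ, hneg⟩ := (mem_continuationSet_iff hlam hc φ).1 hφ
  obtain ⟨T, hT⟩ := exists_lt_expectedIntegral_gainRate_min_const hlam hc hneg
  have hlim : Tendsto (fun ψ => expectedIntegral P (delayRate mu lam p B φ) τ +
      edist ψ φ * (ENNReal.ofReal (∑ i, p i) * T)) (𝓝 φ)
      (𝓝 (expectedIntegral P (delayRate mu lam p B φ) τ)) := by
    have hdist : Tendsto (fun ψ => edist ψ φ) (𝓝 φ) (𝓝 0) := by
      simpa using (continuous_id.edist (continuous_const (y := φ))).tendsto φ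
    simpa using (ENNReal.Tendsto.mul_const hdist (.inr (by finiteness))).const_add
      (expectedIntegral P (delayRate mu lam p B φ) τ)
  filter_upwards [hlim.eventually_lt_const hT] with ψ hψ
  refine (mem_continuationSet_iff hlam hc ψ).2
    ⟨_, (hτ.min_const T).of_ratio hlam hB.continuous hB.zero ψ, ?_⟩
  exact (expectedIntegral_delayRate_min_const_le hlam.le hp hB φ ψ τ T).trans_lt hψ

lemma value_nonpos (φ : State n k) : value mu lam c p B P φ ≤ 0 := by
  refine iInf₂_le_of_le (fun _ => 0) (isStoppingTimeOf_zero _) ?_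
  simp [expectedCost]

lemma value_mono (hlam : 0 < lam) (hp : ∀ i, 0 ≤ p i) (hB : IsStandardBrownian B P)
    {φ ψ : State n k} (h : φ ≤ ψ) : value mu lam c p B P φ ≤ value mu lam c p B P ψ := by
  refine le_iInf₂ fun τ hτ => iInf₂_le_of_le τ (hτ.of_ratio hlam hB.continuous hB.zero φ) ?_
  rw [expectedCost_eq_sub, expectedCost_eq_sub]
  refine EReal.sub_le_sub (EReal.coe_ennreal_le_coe_ennreal_iff.2 ?_) le_rfl
  exact expectedIntegral_mono (fun ω t ht => delayRate_mono hlam.le hp h ht.le ω) τ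

lemma mem_stoppingSet_iff (φ : State n k) :
    φ ∈ stoppingSet mu lam c p B P ↔ φ ∉ continuationSet mu lam c p B P :=
  ⟨fun h => h.not_lt, (value_nonpos φ).eq_of_not_lt⟩

lemma isUpperSet_stoppingSet (hlam : 0 < lam) (hp : ∀ i, 0 ≤ p i) (hB : IsStandardBrownian B P) :
    IsUpperSet (stoppingSet mu lam c p B P) := fun _ ψ h hφ =>
  (value_nonpos ψ).antisymm (hφ.symm.trans_le (value_mono hlam hp hB h))

lemma frontier_continuationSet_subset (hlam : 0 < lam) (hc : 0 < c) (hp : ∀ i, 0 ≤ p i)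
    (hB : IsStandardBrownian B P) :
    frontier (continuationSet mu lam c p B P) ⊆ stoppingSet mu lam c p B P := by
  rw [(isOpen_continuationSet hlam hc hp hB).frontier_eq]
  exact fun φ hφ => (mem_stoppingSet_iff φ).2 hφ.2

end Value

/-! ### Immediate return above the starting point -/

section Regular

variable {Ω : Type*} [MeasurableSpace Ω] {n k : ℕ} {mu lam c : ℝ} {p : Idx n k → ℝ}
  {B : Fin n → ℝ≥0 → Ω → ℝ} {P : Measure Ω}

lemma IsStandardBrownian.neg (hB : IsStandardBrownian B P) : IsStandardBrownian (-B) P where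
  brownian j := (hB.brownian j).neg
  indep := hB.indep.comp (fun _ (x : ℝ≥0 → ℝ) => -x) fun _ => measurable_neg
  measurable j t := (hB.measurable j t).neg
  continuous j ω := (hB.continuous j ω).neg
  zero j ω := by simp [hB.zero]

lemma ae_frequently_forall_sq_mul_le_of_nonneg (hmu : 0 ≤ mu) (hB : IsStandardBrownian B P) :
    ∀ᵐ ω ∂P, ∃ᶠ t in 𝓝[>] (0 : ℝ≥0), ∀ j, mu ^ 2 / 2 * t ≤ mu * B j t ω := by
  filter_upwards [ae_frequently_nhdsGT_zero_forall_mul_le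
    (fun j => (hB.brownian j).toIsPreBrownianReal) hB.indep hB.measurable (mu / 2)] with ω hω
  refine hω.mono fun t ht j => ?_
  calc mu ^ 2 / 2 * t = mu * (mu / 2 * t) := by ring
    _ ≤ mu * B j t ω := mul_le_mul_of_nonneg_left (ht j) hmu

lemma ae_frequently_forall_sq_mul_le (hB : IsStandardBrownian B P) (mu : ℝ) :
    ∀ᵐ ω ∂P, ∃ᶠ t in 𝓝[>] (0 : ℝ≥0), ∀ j, mu ^ 2 / 2 * t ≤ mu * B j t ω := by
  rcases le_total 0 mu with hmu | hmu
  · exact ae_frequently_forall_sq_mul_le_of_nonneg hmu hB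
  · simpa using ae_frequently_forall_sq_mul_le_of_nonneg (neg_nonneg.2 hmu) hB.neg

lemma hittingTime_eq_zero_of_frequently {Ω E : Type*} {Y : ℝ≥0 → Ω → E} {A : Set E} {ω : Ω}
    (h : ∃ᶠ t in 𝓝[>] 0, Y t ω ∈ A) : hittingTime Y A ω = 0 := by
  refine le_antisymm (ENNReal.le_of_forall_pos_le_add fun ε hε _ => ?_) zero_le
  obtain ⟨t, htA, ht0, htε⟩ := (h.and_eventually (Ioc_mem_nhdsGT hε)).exists
  exact iInf₂_le_of_le t ⟨ht0, htA⟩ (by simpa using htε)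

lemma isRegularFor_of_isUpperSet (hlam : 0 ≤ lam) (hB : IsStandardBrownian B P)
    {A : Set (State n k)} (hA : IsUpperSet A) {φ : State n k} (hφ : φ ∈ A) :
    IsRegularFor mu lam B P A φ := by
  filter_upwards [ae_frequently_forall_sq_mul_le hB mu] with ω hω
  exact hittingTime_eq_zero_of_frequently
    (hω.mono fun t ht => hA (le_ratio_of_forall_le hlam φ ht) hφ)

end Regular

end QuickestDetection

open QuickestDetection in
theorem proposition7_general {Ω : Type*} [MeasurableSpace Ω] (P : Measure Ω) {n k : ℕ}
    (mu lam c : ℝ) (hlam : 0 < lam) (hc : 0 < c) (p : Idx n k → ℝ) (hp : ∀ i, 0 ≤ p i)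
    (B : Fin n → ℝ≥0 → Ω → ℝ) (hB : IsStandardBrownian B P) :
    ∀ φ ∈ frontier (continuationSet mu lam c p B P),
      IsRegularFor mu lam B P (stoppingSet mu lam c p B P) φ :=
  fun _ hφ => isRegularFor_of_isUpperSet hlam.le hB (isUpperSet_stoppingSet hlam hp hB)
    (frontier_continuationSet_subset hlam hc hp hB hφ)

theorem proposition7 {Ω : Type*} [MeasurableSpace Ω] (P : Measure Ω) [IsProbabilityMeasure P]
    {n k : ℕ} (hk : 1 ≤ k) (hkn : k < n)
    (mu lam c : ℝ) (hmu : mu ≠ 0) (hlam : 0 < lam) (hc : 0 < c)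
    (p : QuickestDetection.Idx n k → ℝ) (hp : ∀ i, 0 ≤ p i) (hp1 : ∑ i, p i = 1)
    (B : Fin n → ℝ≥0 → Ω → ℝ) (hB : QuickestDetection.IsStandardBrownian B P) :
    ∀ φ ∈ frontier (QuickestDetection.continuationSet mu lam c p B P),
      QuickestDetection.IsRegularFor mu lam B P
        (QuickestDetection.stoppingSet mu lam c p B P) φ :=
  proposition7_general P mu lam c hlam hc p hp B hB
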